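/- Let $K$ be a commutative ring with unit. A representation $(V,G)$ over $K$ consists of a $K$-module $V$ and a group $G$ acting on $V$ by $K$-linear automorphisms. Let $X=\{x_0,x_1,\dots\}$ and $Y=\{y_0,y_1,\dots\}$ be countably infinite sets of variables, $F$ the free group on $Y$, and $\Phi$ the free $KF$-module on $X$. The equalities are the formulas $w\equiv 0$ ($w\in\Phi$; action-type equalities) and $f\equiv 1$ ($f\in F$; group equalities). Formulas are built from equalities by $\vee,\wedge,\neg,\exists x,\exists y$ ($x\in X$, $y\in Y$), and $\Rightarrow$ abbreviates $\neg\,\cdot\vee\cdot\,$; a formula is of action type if it contains neither group equalities nor quantifiers $\exists y$. A formula holds in $(V,G)$ if it is true there under all assignments $X\to V$, $Y\to G$. Identities are equalities; pseudo-identities are the formulas $u_1\vee\dots\vee u_n$ ($n\ge 1$), quasi-identities the formulas $u_1\wedge\dots\wedge u_n\Rightarrow u$ ($n\ge1$), and universal formulas the formulas $u_1\vee\dots\vee u_n\vee\neg v_1\vee\dots\vee\neg v_m$ ($n+m\ge 1$), where all $u_i,v_j,u$ are equalities. A class of representations is axiomatized by a set $T$ of formulas if it consists of exactly those representations over $K$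 in which all formulas of $T$ hold. Varieties, pseudovarieties, quasivarieties and universal classes are the classes axiomatized by sets of identities, pseudo-identities, quasi-identities and universal formulas respectively. A class $\mathfrak X$ is saturated if, for every representation $(V,G)$, $(V,G)\in\mathfrak X$ if and only if $(V,G/N)\in\mathfrak X$, where $N$ is the kernel of the action of $G$ on $V$. It is right-hereditary if $(V,G)\in\mathfrak X$ implies $(V,H)\in\mathfrak X$ for every subgroup $H$ of $G$. It is right-local if $(V,G)\in\mathfrak X$ whenever $(V,H)\in\mathfrak X$ for all finitely generated subgroups $H$ of $G$. **Theorem 2.2.** Let $\mathfrak X$ be a variety (respectively a pseudovariety, a quasivariety, a universal class) of representations over $K$. Then the following are equivalent: 1. $\mathfrak X$ is axiomatized by a set of action-type identities (respectively action-type pseudo-identities, action-type quasi-identities, action-type universal formulas); 2. $\mathfrak X$ is axiomatized by a set of arbitrary action-type formulas; 3. $\mathfrak X$ is saturated, right-hereditary and right-local. -/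

import Mathlib

universe u v

namespace ActionLogic

/-- A representation `(V, G)` over `K`: a `K`-module `V`, a group `G`, and an action of `G` on `V`
by `K`-linear maps. -/
structure GroupRep (K : Type u) [CommRing K] : Type ((max u v) + 1) where
  V : Type (max u v)
  G : Type (max u v)
  [addCommGroup : AddCommGroup V]
  [module : Module K V]
  [group : Group G]
  ρ : Representation K G V

attribute [instance] GroupRep.addCommGroup GroupRep.module GroupRep.group

/-- The elements `x₁u₁ + ⋯ + xₙuₙ` of the free `KF`-module on the countable set `X = {x₀, x₁, …}`,
where `F` is the free group on the countable set `Y = {y₀, y₁, …}`. -/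
abbrev FreeMod (K : Type u) [CommRing K] : Type u := ℕ →₀ MonoidAlgebra K (FreeGroup ℕ)

/-- First order formulas over the free representation `(XKF, F)`. -/
inductive Formula (K : Type u) [CommRing K] : Type u where
  /-- the action-type equality `w ≡ 0` -/
  | actEq (w : FreeMod K) : Formula K
  /-- the group equality `f ≡ 1` -/
  | grpEq (f : FreeGroup ℕ) : Formula K
  | or (a b : Formula K) : Formula K
  | and (a b : Formula K) : Formula K
  | not (a : Formula K) : Formula K
  /-- `∃ xᵢ`, over the module sort -/
  | exX (i : ℕ) (a : Formula K) : Formula K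
  /-- `∃ yⱼ`, over the group sort -/
  | exY (j : ℕ) (a : Formula K) : Formula K

section Semantics

variable {K : Type u} [CommRing K]

/-- The image of `w = ∑ xᵢuᵢ` under the homomorphism `(XKF, F) → (V, G)` that is determined by
`xᵢ ↦ α i` and `yⱼ ↦ β j`. -/
noncomputable def GroupRep.eval (R : GroupRep.{u, v} K) (α : ℕ → R.V) (β : ℕ → R.G)
    (w : FreeMod K) : R.V :=
  w.sum fun i r => Representation.asAlgebraHom (R.ρ.comp (FreeGroup.lift β)) r (α i)

/-- `R.Sat φ α β`: the homomorphism `(XKF, F) → (V, G)` determined by `xᵢ ↦ α i` and `yⱼ ↦ β j`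
belongs to the value of the formula `φ` in `(V, G)`. -/
def GroupRep.Sat (R : GroupRep.{u, v} K) : Formula K → (ℕ → R.V) → (ℕ → R.G) → Prop
  | .actEq w, α, β => R.eval α β w = 0
  | .grpEq f, _, β => FreeGroup.lift β f = 1
  | .or a b, α, β => R.Sat a α β ∨ R.Sat b α β
  | .and a b, α, β => R.Sat a α β ∧ R.Sat b α β
  | .not a, α, β => ¬ R.Sat a α β
  | .exX i a, α, β => ∃ m : R.V, R.Sat a (Function.update α i m) β
  | .exY j a, α, β => ∃ g : R.G, R.Sat a α (Function.update β j g)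

/-- A formula holds in `(V, G)` if its value is the set of all homomorphisms `(XKF, F) → (V, G)`. -/
def GroupRep.Holds (R : GroupRep.{u, v} K) (φ : Formula K) : Prop :=
  ∀ (α : ℕ → R.V) (β : ℕ → R.G), R.Sat φ α β

namespace Formula

/-- Equalities `w ≡ 0` and `f ≡ 1`. -/
inductive IsEquality : Formula K → Prop
  | actEq (w : FreeMod K) : IsEquality (.actEq w)
  | grpEq (f : FreeGroup ℕ) : IsEquality (.grpEq f)

/-- Equalities and negated equalities. -/
inductive IsLiteral : Formula K → Prop
  | pos {a : Formula K} (h : IsEquality a) : IsLiteral a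
  | neg {a : Formula K} (h : IsEquality a) : IsLiteral (.not a)

/-- Action-type formulas: no group equalities and no quantifiers over the group sort. -/
def IsActionType : Formula K → Prop
  | .actEq _ => True
  | .grpEq _ => False
  | .or a b => IsActionType a ∧ IsActionType b
  | .and a b => IsActionType a ∧ IsActionType b
  | .not a => IsActionType a
  | .exX _ a => IsActionType a
  | .exY _ _ => False

/-- The disjunction `a ∨ b₁ ∨ ⋯ ∨ bₙ` of the non-empty list `a :: [b₁, …, bₙ]`. -/
def disj (a : Formula K) : List (Formula K) → Formula K
  | [] => a
  | b :: l => .or a (disj b l)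

/-- The conjunction `a ∧ b₁ ∧ ⋯ ∧ bₙ` of the non-empty list `a :: [b₁, …, bₙ]`. -/
def conj (a : Formula K) : List (Formula K) → Formula K
  | [] => a
  | b :: l => .and a (conj b l)

/-- `a ⟹ b`. -/
def imp (a b : Formula K) : Formula K := .or (.not a) b

/-- Pseudo-identities `u₁ ∨ ⋯ ∨ uₙ`, with `n ≥ 1` equalities `uᵢ`. -/
def IsPseudoIdentity (φ : Formula K) : Prop :=
  ∃ (a : Formula K) (l : List (Formula K)), (∀ b ∈ a :: l, IsEquality b) ∧ φ = disj a l

/-- Quasi-identities `u₁ ∧ ⋯ ∧ uₙ ⟹ u`, with equalities `uᵢ` (`n ≥ 1`) and `u`. An equality `u` is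
equivalent to the quasi-identity `0 ≡ 0 ⟹ u`. -/
def IsQuasiIdentity (φ : Formula K) : Prop :=
  ∃ (a : Formula K) (l : List (Formula K)) (c : Formula K),
    (∀ b ∈ a :: l, IsEquality b) ∧ IsEquality c ∧ φ = imp (conj a l) c

/-- Universal formulas: disjunctions of finitely many, but at least one, equalities and negated
equalities. -/
def IsUniversal (φ : Formula K) : Prop :=
  ∃ (a : Formula K) (l : List (Formula K)), (∀ b ∈ a :: l, IsLiteral b) ∧ φ = disj a l

end Formula

/-- `X = T*` for some set `T` of formulas all of which have the property `P`. -/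
def AxiomatizableBy (P : Formula K → Prop) (X : Set (GroupRep.{u, v} K)) : Prop :=
  ∃ T : Set (Formula K), (∀ φ ∈ T, P φ) ∧ X = {R | ∀ φ ∈ T, R.Holds φ}

def IsVariety (X : Set (GroupRep.{u, v} K)) : Prop :=
  AxiomatizableBy Formula.IsEquality X

def IsPseudovariety (X : Set (GroupRep.{u, v} K)) : Prop :=
  AxiomatizableBy Formula.IsPseudoIdentity X

def IsQuasivariety (X : Set (GroupRep.{u, v} K)) : Prop :=
  AxiomatizableBy Formula.IsQuasiIdentity X

def IsUniversalClass (X : Set (GroupRep.{u, v} K)) : Prop :=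
  AxiomatizableBy Formula.IsUniversal X

/-- Classes given by arbitrary action-type formulas. -/
def IsActionAxiomatizable (X : Set (GroupRep.{u, v} K)) : Prop :=
  AxiomatizableBy Formula.IsActionType X

def IsActionVariety (X : Set (GroupRep.{u, v} K)) : Prop :=
  AxiomatizableBy (fun φ => φ.IsEquality ∧ φ.IsActionType) X

def IsActionPseudovariety (X : Set (GroupRep.{u, v} K)) : Prop :=
  AxiomatizableBy (fun φ => φ.IsPseudoIdentity ∧ φ.IsActionType) X

def IsActionQuasivariety (X : Set (GroupRep.{u, v} K)) : Prop :=
  AxiomatizableBy (fun φ => φ.IsQuasiIdentity ∧ φ.IsActionType) X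

def IsActionUniversalClass (X : Set (GroupRep.{u, v} K)) : Prop :=
  AxiomatizableBy (fun φ => φ.IsUniversal ∧ φ.IsActionType) X

end Semantics

section Closure

variable {K : Type u} [CommRing K]

/-- The faithful representation `(V, G / Ker)` corresponding to `(V, G)`. -/
def GroupRep.faithful (R : GroupRep.{u, v} K) : GroupRep.{u, v} K where
  V := R.V
  G := R.G ⧸ MonoidHom.ker R.ρ
  ρ := QuotientGroup.lift (MonoidHom.ker R.ρ) R.ρ fun _ h => MonoidHom.mem_ker.1 h

/-- The restriction `(V, H)` of `(V, G)` to a subgroup `H` of `G`. -/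
def GroupRep.restrict (R : GroupRep.{u, v} K) (H : Subgroup R.G) : GroupRep.{u, v} K where
  V := R.V
  G := H
  ρ := R.ρ.comp H.subtype

def IsSaturated (X : Set (GroupRep.{u, v} K)) : Prop :=
  ∀ R : GroupRep.{u, v} K, R ∈ X ↔ R.faithful ∈ X

def IsRightHereditary (X : Set (GroupRep.{u, v} K)) : Prop :=
  ∀ R ∈ X, ∀ H : Subgroup R.G, R.restrict H ∈ X

def IsRightLocal (X : Set (GroupRep.{u, v} K)) : Prop :=
  ∀ R : GroupRep.{u, v} K, (∀ H : Subgroup R.G, H.FG → R.restrict H ∈ X) → R ∈ X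

/-- Saturated, right-hereditary and right-local. -/
def IsStrictlySaturated (X : Set (GroupRep.{u, v} K)) : Prop :=
  IsSaturated X ∧ IsRightHereditary X ∧ IsRightLocal X

end Closure

end ActionLogic

open ActionLogic

/-! An action-type formula sees a group element only through its operator on the module, so its
truth passes along homomorphisms of acting groups. It also mentions only finitely many group
variables. These two facts give saturation, right-heredity and right-locality
(`IsActionAxiomatizable.isStrictlySaturated`).

For the converse, saturation lets the acting group be replaced by any group mapping onto it
(`mem_comap_iff`), in particular by a free group. Over free generators a group equality between
given words has a truth value fixed in advance, so substituting words into a quantifier-free axiom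
leaves an action-type formula, again valid in the class (`holds_subst`). By right-locality these
instances suffice: a finitely generated group is countable, hence an image of the free group of
countable rank, where every assignment is a substitution of words. It remains to give each instance
the required shape; when an instance is false everywhere, or a quasi-identity acquires a false
conclusion, the trivial representation gives a contradiction. -/

namespace ActionLogic

section Semantics

variable {K : Type u} [CommRing K]

/-! ### Change of the acting group -/

/-- The representation of `H` obtained from `(V, G)` by pulling back along `H →* G`. -/
def GroupRep.comap (R : GroupRep.{u, v} K) {H : Type (max u v)} [Group H] (f : H →* R.G) :
    GroupRep.{u, v} K where
  V := R.V
  G := H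
  ρ := R.ρ.comp f

theorem GroupRep.eval_comap (R : GroupRep.{u, v} K) {H : Type (max u v)} [Group H]
    (f : H →* R.G) (α : ℕ → R.V) (β : ℕ → H) (w : FreeMod K) :
    (R.comap f).eval α β w = R.eval α (fun j => f (β j)) w := by
  have h : (R.ρ.comp f).comp (FreeGroup.lift β) =
      R.ρ.comp (FreeGroup.lift fun j => f (β j)) := by
    ext1 j
    simp
  change (w.sum fun i r =>
    Representation.asAlgebraHom ((R.ρ.comp f).comp (FreeGroup.lift β)) r (α i)) = _
  rw [h]
  rfl

/-- The module quantifiers range over the same `V` on both sides, and equalities in `V` depend only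
on the operators. Without a restriction on the formula, group equalities would detect the kernel of
`f`. -/
theorem GroupRep.sat_comap (R : GroupRep.{u, v} K) {H : Type (max u v)} [Group H]
    (f : H →* R.G) {φ : Formula K} (hφ : φ.IsActionType) (α : ℕ → R.V) (β : ℕ → H) :
    (R.comap f).Sat φ α β ↔ R.Sat φ α fun j => f (β j) := by
  induction φ generalizing α with
  | actEq w =>
    change (R.comap f).eval α β w = 0 ↔ R.eval α _ w = 0
    rw [GroupRep.eval_comap]
    rfl
  | grpEq g => exact hφ.elim
  | or a b iha ihb => exact or_congr (iha hφ.1 α) (ihb hφ.2 α)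
  | and a b iha ihb => exact and_congr (iha hφ.1 α) (ihb hφ.2 α)
  | not a iha => exact not_congr (iha hφ α)
  | exX i a iha => exact exists_congr fun m => iha hφ _
  | exY j a iha => exact hφ.elim

theorem GroupRep.sat_comap_mulEquiv (R : GroupRep.{u, v} K) {H : Type (max u v)} [Group H]
    (e : H ≃* R.G) (φ : Formula K) (α : ℕ → R.V) (β : ℕ → H) :
    (R.comap e.toMonoidHom).Sat φ α β ↔ R.Sat φ α fun j => e (β j) := by
  induction φ generalizing α β with
  | actEq w =>
    change (R.comap e.toMonoidHom).eval α β w = 0 ↔ R.eval α _ w = 0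
    rw [GroupRep.eval_comap]
    rfl
  | grpEq g =>
    have h : FreeGroup.lift (fun j => e (β j)) = e.toMonoidHom.comp (FreeGroup.lift β) := by
      ext1 j
      simp
    change FreeGroup.lift β g = 1 ↔ FreeGroup.lift (fun j => e (β j)) g = 1
    rw [h]
    simp
  | or a b iha ihb => exact or_congr (iha α β) (ihb α β)
  | and a b iha ihb => exact and_congr (iha α β) (ihb α β)
  | not a iha => exact not_congr (iha α β)
  | exX i a iha => exact exists_congr fun m => iha _ β
  | exY j a iha =>
    refine e.toEquiv.exists_congr fun g => (iha α (Function.update β j g)).trans ?_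
    have h : (fun k => e (Function.update β j g k)) =
        Function.update (fun k => e (β k)) j (e g) :=
      Function.comp_update e β j g
    rw [h]
    rfl

theorem GroupRep.holds_comap_mulEquiv (R : GroupRep.{u, v} K) {H : Type (max u v)} [Group H]
    (e : H ≃* R.G) (φ : Formula K) : (R.comap e.toMonoidHom).Holds φ ↔ R.Holds φ := by
  refine ⟨fun h α β => ?_, fun h α β => (R.sat_comap_mulEquiv e φ α β).2 (h _ _)⟩
  simpa using (R.sat_comap_mulEquiv e φ α fun j => e.symm (β j)).1 (h _ _)

theorem GroupRep.Holds.comap {R : GroupRep.{u, v} K} {H : Type (max u v)} [Group H]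
    {f : H →* R.G} {φ : Formula K} (h : R.Holds φ) (hφ : φ.IsActionType) :
    (R.comap f).Holds φ :=
  fun α β => (R.sat_comap f hφ α β).2 (h _ _)

theorem GroupRep.Holds.of_comap {R : GroupRep.{u, v} K} {H : Type (max u v)} [Group H]
    {f : H →* R.G} {φ : Formula K} (h : (R.comap f).Holds φ) (hf : Function.Surjective f)
    (hφ : φ.IsActionType) : R.Holds φ := by
  intro α β
  choose g hg using hf
  simpa [hg] using (R.sat_comap f hφ α fun j => g (β j)).1 (h _ _)

/-- The kernel of the pulled-back action is the preimage under `f` of the kernel of `R.ρ`, so `f`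
induces an isomorphism of the quotients. -/
theorem GroupRep.exists_faithful_comap (R : GroupRep.{u, v} K) {H : Type (max u v)} [Group H]
    (f : H →* R.G) (hf : Function.Surjective f) :
    ∃ e : (R.comap f).faithful.G ≃* R.faithful.G,
      (R.comap f).faithful = R.faithful.comap e.toMonoidHom := by
  have hle : MonoidHom.ker (R.ρ.comp f) ≤ (MonoidHom.ker R.ρ).comap f := fun h hh => hh
  let q : H ⧸ MonoidHom.ker (R.ρ.comp f) →* R.G ⧸ MonoidHom.ker R.ρ :=
    QuotientGroup.map _ _ f hle
  have hq : Function.Bijective q := by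
    constructor
    · rw [injective_iff_map_eq_one]
      intro x
      induction x using QuotientGroup.induction_on with
      | H x =>
        intro hx
        exact (QuotientGroup.eq_one_iff x).2 ((QuotientGroup.eq_one_iff (f x)).1 hx)
    · intro y
      induction y using QuotientGroup.induction_on with
      | H y =>
        obtain ⟨x, rfl⟩ := hf y
        exact ⟨QuotientGroup.mk x, rfl⟩
  refine ⟨MulEquiv.ofBijective q hq, ?_⟩
  have h : QuotientGroup.lift (MonoidHom.ker (R.ρ.comp f)) (R.ρ.comp f)
      (fun _ h => MonoidHom.mem_ker.1 h) = R.faithful.ρ.comp q := by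
    ext x
    rfl
  exact congrArg (fun ρ : Representation K (H ⧸ MonoidHom.ker (R.ρ.comp f)) R.V =>
    ({ V := R.V, G := H ⧸ MonoidHom.ker (R.ρ.comp f), ρ := ρ } : GroupRep.{u, v} K)) h

/-- A saturated class of models sees only the image of the acting group. -/
theorem mem_comap_iff {P : Formula K → Prop} {X : Set (GroupRep.{u, v} K)}
    (hX : AxiomatizableBy P X) (hs : IsSaturated X) (R : GroupRep.{u, v} K)
    {H : Type (max u v)} [Group H] (f : H →* R.G) (hf : Function.Surjective f) :
    R.comap f ∈ X ↔ R ∈ X := by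
  obtain ⟨T, -, rfl⟩ := hX
  obtain ⟨e, he⟩ := R.exists_faithful_comap f hf
  rw [hs R, hs (R.comap f), he]
  -- Being a class of models is used here: it makes `X` invariant under isomorphism of the acting
  -- group.
  exact forall₂_congr fun φ _ => R.faithful.holds_comap_mulEquiv e φ

/-! ### Finite dependence on the group variables -/

theorem exists_finset_lift_eq (g : FreeGroup ℕ) :
    ∃ s : Finset ℕ, ∀ {G : Type v} [Group G] (β β' : ℕ → G), (∀ j ∈ s, β j = β' j) →
      FreeGroup.lift β g = FreeGroup.lift β' g := by
  induction g using FreeGroup.induction_on with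
  | C1 => exact ⟨∅, by simp⟩
  | of j => exact ⟨{j}, by simp⟩
  | inv_of j _ => exact ⟨{j}, by simp⟩
  | mul x y hx hy =>
    obtain ⟨s, hs⟩ := hx
    obtain ⟨t, ht⟩ := hy
    refine ⟨s ∪ t, fun β β' h => ?_⟩
    rw [map_mul, map_mul, hs β β' fun j hj => h j (Finset.mem_union_left _ hj),
      ht β β' fun j hj => h j (Finset.mem_union_right _ hj)]

theorem exists_finset_asAlgebraHom_eq (r : MonoidAlgebra K (FreeGroup ℕ)) :
    ∃ s : Finset ℕ, ∀ (R : GroupRep.{u, v} K) (β β' : ℕ → R.G), (∀ j ∈ s, β j = β' j) →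
      Representation.asAlgebraHom (R.ρ.comp (FreeGroup.lift β)) r =
        Representation.asAlgebraHom (R.ρ.comp (FreeGroup.lift β')) r := by
  induction r using MonoidAlgebra.induction_on with
  | of g =>
    obtain ⟨s, hs⟩ := exists_finset_lift_eq.{max u v} g
    refine ⟨s, fun R β β' h => ?_⟩
    simp [hs β β' h]
  | add x y hx hy =>
    obtain ⟨s, hs⟩ := hx
    obtain ⟨t, ht⟩ := hy
    refine ⟨s ∪ t, fun R β β' h => ?_⟩
    rw [map_add, map_add, hs R β β' fun j hj => h j (Finset.mem_union_left _ hj),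
      ht R β β' fun j hj => h j (Finset.mem_union_right _ hj)]
  | smul c x hx =>
    obtain ⟨s, hs⟩ := hx
    refine ⟨s, fun R β β' h => ?_⟩
    rw [map_smul, map_smul, hs R β β' h]

theorem exists_finset_eval_eq (w : FreeMod K) :
    ∃ s : Finset ℕ, ∀ (R : GroupRep.{u, v} K) (α : ℕ → R.V) (β β' : ℕ → R.G),
      (∀ j ∈ s, β j = β' j) → R.eval α β w = R.eval α β' w := by
  choose s hs using exists_finset_asAlgebraHom_eq.{u, v} (K := K)
  refine ⟨w.support.biUnion fun i => s (w i), fun R α β β' h => ?_⟩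
  refine Finset.sum_congr rfl fun i hi => ?_
  dsimp only
  rw [hs (w i) R β β' fun j hj => h j (Finset.mem_biUnion.2 ⟨i, hi, hj⟩)]

theorem exists_finset_sat_iff {φ : Formula K} (hφ : φ.IsActionType) :
    ∃ s : Finset ℕ, ∀ (R : GroupRep.{u, v} K) (α : ℕ → R.V) (β β' : ℕ → R.G),
      (∀ j ∈ s, β j = β' j) → (R.Sat φ α β ↔ R.Sat φ α β') := by
  induction φ with
  | actEq w =>
    obtain ⟨s, hs⟩ := exists_finset_eval_eq.{u, v} w
    exact ⟨s, fun R α β β' h => by simp only [GroupRep.Sat, hs R α β β' h]⟩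
  | grpEq g => exact hφ.elim
  | or a b iha ihb =>
    obtain ⟨s, hs⟩ := iha hφ.1
    obtain ⟨t, ht⟩ := ihb hφ.2
    exact ⟨s ∪ t, fun R α β β' h =>
      or_congr (hs R α β β' fun j hj => h j (Finset.mem_union_left _ hj))
        (ht R α β β' fun j hj => h j (Finset.mem_union_right _ hj))⟩
  | and a b iha ihb =>
    obtain ⟨s, hs⟩ := iha hφ.1
    obtain ⟨t, ht⟩ := ihb hφ.2
    exact ⟨s ∪ t, fun R α β β' h =>
      and_congr (hs R α β β' fun j hj => h j (Finset.mem_union_left _ hj))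
        (ht R α β β' fun j hj => h j (Finset.mem_union_right _ hj))⟩
  | not a iha =>
    obtain ⟨s, hs⟩ := iha hφ
    exact ⟨s, fun R α β β' h => not_congr (hs R α β β' h)⟩
  | exX i a iha =>
    obtain ⟨s, hs⟩ := iha hφ
    exact ⟨s, fun R α β β' h => exists_congr fun m => hs R _ β β' h⟩
  | exY j a iha => exact hφ.elim

theorem IsActionAxiomatizable.isStrictlySaturated {X : Set (GroupRep.{u, v} K)}
    (hX : IsActionAxiomatizable X) : IsStrictlySaturated X := by
  obtain ⟨T, hT, rfl⟩ := hX
  refine ⟨fun R => forall₂_congr fun φ hφ => ⟨fun h => ?_, fun h => ?_⟩,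
    fun R hR H φ hφ => (hR φ hφ).comap (f := H.subtype) (hT φ hφ), ?_⟩
  · exact GroupRep.Holds.of_comap (R := R.faithful)
      (f := QuotientGroup.mk' (MonoidHom.ker R.ρ)) h (QuotientGroup.mk'_surjective _) (hT φ hφ)
  · exact GroupRep.Holds.comap (R := R.faithful)
      (f := QuotientGroup.mk' (MonoidHom.ker R.ρ)) h (hT φ hφ)
  · classical
    intro R hR φ hφ α β
    obtain ⟨s, hs⟩ := exists_finset_sat_iff.{u, v} (hT φ hφ)
    let H : Subgroup R.G := Subgroup.closure (s.image β : Finset R.G)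
    have hβ : ∀ j ∈ s, β j ∈ H := fun j hj =>
      Subgroup.subset_closure (Finset.mem_coe.2 (Finset.mem_image_of_mem β hj))
    -- Only the values on `s` matter, so the assignment may be moved into `H` by sending all other
    -- variables to 1.
    let β' : ℕ → H := fun j => if hj : j ∈ s then ⟨β j, hβ j hj⟩ else 1
    refine (hs R α β (fun j => H.subtype (β' j)) fun j hj => ?_).2
      ((R.sat_comap H.subtype (hT φ hφ) α β').1 (hR H ⟨_, rfl⟩ φ hφ α β'))
    simp [β', hj]

/-! ### Substituting words for group variables -/

/-- The substitution `yⱼ ↦ γ j` in `w`. -/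
noncomputable def FreeMod.subst (γ : ℕ → FreeGroup ℕ) (w : FreeMod K) : FreeMod K :=
  w.mapRange (MonoidAlgebra.mapDomainAlgHom K K (FreeGroup.lift γ)) (map_zero _)

theorem GroupRep.eval_subst (R : GroupRep.{u, v} K) (γ : ℕ → FreeGroup ℕ) (α : ℕ → R.V)
    (β : ℕ → R.G) (w : FreeMod K) :
    R.eval α β (w.subst γ) = R.eval α (fun j => FreeGroup.lift β (γ j)) w := by
  have h : (Representation.asAlgebraHom (R.ρ.comp (FreeGroup.lift β))).comp
      (MonoidAlgebra.mapDomainAlgHom K K (FreeGroup.lift γ)) =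
      Representation.asAlgebraHom
        (R.ρ.comp (FreeGroup.lift fun j => FreeGroup.lift β (γ j))) := by
    have h' : (FreeGroup.lift β).comp (FreeGroup.lift γ) =
        FreeGroup.lift fun j => FreeGroup.lift β (γ j) := by
      ext1 j
      simp
    rw [← h']
    ext g
    simp
  rw [GroupRep.eval, FreeMod.subst, Finsupp.sum_mapRange_index (by simp), GroupRep.eval, ← h]
  rfl

namespace Formula

/-- Formulas without quantifiers. -/
def IsQuantifierFree : Formula K → Prop
  | .actEq _ => True
  | .grpEq _ => True
  | .or a b => IsQuantifierFree a ∧ IsQuantifierFree b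
  | .and a b => IsQuantifierFree a ∧ IsQuantifierFree b
  | .not a => IsQuantifierFree a
  | .exX _ _ => False
  | .exY _ _ => False

open scoped Classical in
/-- The substitution `yⱼ ↦ γ j`, after which each group equality is replaced by its truth value
in the free group. -/
noncomputable def subst (γ : ℕ → FreeGroup ℕ) : Formula K → Formula K
  | .actEq w => .actEq (w.subst γ)
  | .grpEq f => if FreeGroup.lift γ f = 1 then .actEq 0 else .not (.actEq 0)
  | .or a b => .or (subst γ a) (subst γ b)
  | .and a b => .and (subst γ a) (subst γ b)
  | .not a => .not (subst γ a)
  | .exX i a => .exX i (subst γ a)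
  | .exY j a => .exY j (subst γ a)

end Formula

@[simp]
theorem GroupRep.sat_zero (R : GroupRep.{u, v} K) (α : ℕ → R.V) (β : ℕ → R.G) :
    R.Sat (.actEq 0) α β :=
  Finsupp.sum_zero_index

theorem Formula.IsQuantifierFree.isActionType_subst {φ : Formula K} (hφ : φ.IsQuantifierFree)
    (γ : ℕ → FreeGroup ℕ) : (φ.subst γ).IsActionType := by
  induction φ with
  | actEq w => trivial
  | grpEq f => unfold subst; split <;> trivial
  | or a b iha ihb => exact ⟨iha hφ.1, ihb hφ.2⟩
  | and a b iha ihb => exact ⟨iha hφ.1, ihb hφ.2⟩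
  | not a iha => exact iha hφ
  | exX i a iha => exact hφ.elim
  | exY j a iha => exact hφ.elim

/-- Injectivity makes `f ≡ 1` at the substituted words true exactly when `f` becomes trivial in the
free group, which is the truth value that `Formula.subst` records. -/
theorem GroupRep.sat_subst (R : GroupRep.{u, v} K) {φ : Formula K} (hφ : φ.IsQuantifierFree)
    (γ : ℕ → FreeGroup ℕ) (α : ℕ → R.V) {β : ℕ → R.G}
    (hβ : Function.Injective (FreeGroup.lift β)) :
    R.Sat (φ.subst γ) α β ↔ R.Sat φ α fun j => FreeGroup.lift β (γ j) := by
  induction φ with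
  | actEq w => exact iff_of_eq (congrArg (· = 0) (R.eval_subst γ α β w))
  | grpEq f =>
    have h : FreeGroup.lift (fun j => FreeGroup.lift β (γ j)) =
        (FreeGroup.lift β).comp (FreeGroup.lift γ) := by
      ext1 j
      simp
    have h' : R.Sat (.grpEq f) α (fun j => FreeGroup.lift β (γ j)) ↔ FreeGroup.lift γ f = 1 := by
      rw [GroupRep.Sat, h]
      exact map_eq_one_iff _ hβ
    rw [h', Formula.subst]
    split <;> simp_all [GroupRep.Sat, GroupRep.eval]
  | or a b iha ihb => exact or_congr (iha hφ.1) (ihb hφ.2)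
  | and a b iha ihb => exact and_congr (iha hφ.1) (ihb hφ.2)
  | not a iha => exact not_congr (iha hφ)
  | exX i a iha => exact hφ.elim
  | exY j a iha => exact hφ.elim

/-- An assignment in `R` is lifted to free generators of a free group over `R.G`. Saturation keeps
the pullback in `X`, and the instance, being action-type, descends to `R`. -/
theorem holds_subst {P : Formula K → Prop} {X : Set (GroupRep.{u, v} K)}
    (hX : AxiomatizableBy P X) (hs : IsSaturated X) {φ : Formula K} (hφ : φ.IsQuantifierFree)
    (h : ∀ R ∈ X, R.Holds φ) (γ : ℕ → FreeGroup ℕ) (R : GroupRep.{u, v} K) (hR : R ∈ X) :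
    R.Holds (φ.subst γ) := by
  intro α β
  let π : FreeGroup (R.G × ℕ) →* R.G := FreeGroup.lift Prod.fst
  have hπ : Function.Surjective π := fun g => ⟨.of (g, 0), by simp [π]⟩
  -- The second coordinate keeps the generators distinct where `β` repeats a value.
  let β' : ℕ → FreeGroup (R.G × ℕ) := fun j => .of (β j, j)
  have hβ' : Function.Injective (FreeGroup.lift β') := by
    have h : FreeGroup.lift β' = FreeGroup.map fun j => (β j, j) := by
      ext1 j
      simp [β']
    rw [h]
    exact FreeGroup.map_injective fun i j hij => congrArg Prod.snd hij
  have := (R.sat_comap π (hφ.isActionType_subst γ) α β').1 <|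
    ((R.comap π).sat_subst hφ γ α hβ').2 (h _ ((mem_comap_iff hX hs R π hπ).2 hR) _ _)
  simpa [π, β'] using this

/-- If every substitution instance valid in `X` follows from a formula of the same kind that is
action-type and valid in `X`, then `X` has action-type axioms of that kind. -/
theorem IsStrictlySaturated.axiomatizableBy {P : Formula K → Prop} {X : Set (GroupRep.{u, v} K)}
    (hs : IsStrictlySaturated X) (hX : AxiomatizableBy P X)
    (hP : ∀ φ, P φ → φ.IsQuantifierFree)
    (hsub : ∀ φ γ, P φ → (∀ R ∈ X, R.Holds (φ.subst γ)) →
      ∃ ψ, (P ψ ∧ ψ.IsActionType) ∧ (∀ R ∈ X, R.Holds ψ) ∧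
        ∀ (R : GroupRep.{u, v} K) α β, R.Sat ψ α β → R.Sat (φ.subst γ) α β) :
    AxiomatizableBy (fun φ => P φ ∧ φ.IsActionType) X := by
  refine ⟨{ψ | (P ψ ∧ ψ.IsActionType) ∧ ∀ R ∈ X, R.Holds ψ}, fun ψ h => h.1,
    Set.Subset.antisymm (fun R hR ψ hψ => hψ.2 R hR) fun R hR => hs.2.2 R fun H hH => ?_⟩
  have hH' : Group.FG H := (Group.fg_iff_subgroup_fg H).2 hH
  have : Countable H := by
    obtain ⟨S, _, p, hp⟩ := Group.fg_iff_exists_freeGroup_hom_surjective_finite.1 hH'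
    have : Countable (FreeGroup S) := Quot.mk_surjective.countable
    exact hp.countable
  obtain ⟨f, hf⟩ := exists_surjective_nat H
  -- Countable rank lets the elements of this group be read as words in the variables `yⱼ`; `ULift`
  -- only adjusts the universe.
  let π : FreeGroup (ULift.{max u v} ℕ) →* H := FreeGroup.lift fun j => f j.down
  have hπ : Function.Surjective π := fun g => by
    obtain ⟨j, rfl⟩ := hf g
    exact ⟨.of ⟨j⟩, by simp [π]⟩
  refine (mem_comap_iff hX hs.1 (R.restrict H) π hπ).1 ?_
  obtain ⟨T, hT, hXT⟩ := id hX
  rw [hXT]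
  intro φ hφ α β
  -- The assignment `β` itself becomes a substitution, evaluated below at the free generators `β₀`.
  let γ : ℕ → FreeGroup ℕ := fun j => FreeGroup.map ULift.down (β j)
  have hγ := holds_subst hX hs.1 (hP φ (hT φ hφ)) (fun S hS => (hXT ▸ hS :) φ hφ) γ
  obtain ⟨ψ, hψ, hψX, himp⟩ := hsub φ γ (hT φ hφ) hγ
  let β₀ : ℕ → FreeGroup (ULift.{max u v} ℕ) := fun j => .of ⟨j⟩
  have hβ₀ : FreeGroup.lift β₀ = FreeGroup.map ULift.up := by
    ext1 j
    simp [β₀]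
  have hinj : Function.Injective (FreeGroup.lift β₀) := by
    rw [hβ₀]
    exact FreeGroup.map_injective ULift.up_injective
  have hβ : (fun j => FreeGroup.lift β₀ (γ j)) = β := by
    funext j
    rw [hβ₀]
    exact (FreeGroup.map.comp _ _ _).trans (FreeGroup.map.id _)
  rw [← hβ]
  refine (GroupRep.sat_subst _ (hP φ (hT φ hφ)) γ α hinj).1 (himp _ _ _ ?_)
  exact ((hR ψ ⟨hψ, hψX⟩).comap (f := H.subtype.comp π) hψ.2) α β₀

/-! ### Shapes of the substitution instances -/

/-- The zero module with the trivial group. -/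
def GroupRep.trivial (K : Type u) [CommRing K] : GroupRep.{u, v} K where
  V := PUnit
  G := PUnit
  ρ := 1

theorem GroupRep.trivial_sat_actEq (w : FreeMod K) (α β) :
    (GroupRep.trivial.{u, v} K).Sat (.actEq w) α β :=
  Subsingleton.elim (α := PUnit) _ _

theorem GroupRep.trivial_sat {a : Formula K} (ha : a.IsEquality) (α β) :
    (GroupRep.trivial.{u, v} K).Sat a α β := by
  cases ha with
  | actEq w => exact GroupRep.trivial_sat_actEq w α β
  | grpEq f => exact Subsingleton.elim (α := PUnit) _ _

theorem GroupRep.sat_disj (R : GroupRep.{u, v} K) (a : Formula K) (l : List (Formula K))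
    (α : ℕ → R.V) (β : ℕ → R.G) :
    R.Sat (Formula.disj a l) α β ↔ ∃ b ∈ a :: l, R.Sat b α β := by
  induction l generalizing a with
  | nil => simp [Formula.disj]
  | cons b l ih => rw [List.exists_mem_cons_iff, ← ih b]; rfl

theorem GroupRep.sat_conj (R : GroupRep.{u, v} K) (a : Formula K) (l : List (Formula K))
    (α : ℕ → R.V) (β : ℕ → R.G) :
    R.Sat (Formula.conj a l) α β ↔ ∀ b ∈ a :: l, R.Sat b α β := by
  induction l generalizing a with
  | nil => simp [Formula.conj]
  | cons b l ih => rw [List.forall_mem_cons, ← ih b]; rfl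

namespace Formula

theorem IsEquality.isQuantifierFree {a : Formula K} (ha : a.IsEquality) :
    a.IsQuantifierFree := by
  cases ha <;> trivial

theorem IsLiteral.isQuantifierFree {a : Formula K} (ha : a.IsLiteral) :
    a.IsQuantifierFree := by
  cases ha with
  | pos h => exact h.isQuantifierFree
  | neg h => exact h.isQuantifierFree

theorem isQuantifierFree_disj {a : Formula K} {l : List (Formula K)}
    (h : ∀ b ∈ a :: l, b.IsQuantifierFree) : (disj a l).IsQuantifierFree := by
  induction l generalizing a with
  | nil => exact h a (by simp)
  | cons b l ih =>
    rw [List.forall_mem_cons] at h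
    exact ⟨h.1, ih h.2⟩

theorem isQuantifierFree_conj {a : Formula K} {l : List (Formula K)}
    (h : ∀ b ∈ a :: l, b.IsQuantifierFree) : (conj a l).IsQuantifierFree := by
  induction l generalizing a with
  | nil => exact h a (by simp)
  | cons b l ih =>
    rw [List.forall_mem_cons] at h
    exact ⟨h.1, ih h.2⟩

theorem isActionType_conj {a : Formula K} {l : List (Formula K)}
    (h : ∀ b ∈ a :: l, b.IsActionType) : (conj a l).IsActionType := by
  induction l generalizing a with
  | nil => exact h a (by simp)
  | cons b l ih =>
    rw [List.forall_mem_cons] at h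
    exact ⟨h.1, ih h.2⟩

/-- A substitution instance of an equality is an action-type equality or is false everywhere. -/
theorem IsEquality.subst_cases {a : Formula K} (ha : a.IsEquality) (γ : ℕ → FreeGroup ℕ) :
    (∃ w, a.subst γ = .actEq w) ∨ a.subst γ = .not (.actEq 0) := by
  cases ha with
  | actEq w => exact .inl ⟨_, rfl⟩
  | grpEq f =>
    unfold subst
    split
    · exact .inl ⟨_, rfl⟩
    · exact .inr rfl

theorem not_sat_not_zero (R : GroupRep.{u, v} K) (α : ℕ → R.V) (β : ℕ → R.G) :
    ¬ R.Sat (.not (.actEq 0)) α β :=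
  not_not_intro (R.sat_zero α β)

/-- False disjuncts can be dropped; what remains is a pseudo-identity unless nothing is left. -/
theorem disj_subst_cases {a : Formula K} {l : List (Formula K)}
    (h : ∀ b ∈ a :: l, b.IsEquality) (γ : ℕ → FreeGroup ℕ) :
    (∀ (R : GroupRep.{u, v} K) α β, ¬ R.Sat ((disj a l).subst γ) α β) ∨
      ∃ ψ : Formula K, (ψ.IsPseudoIdentity ∧ ψ.IsActionType) ∧
        ∀ (R : GroupRep.{u, v} K) α β, R.Sat ψ α β ↔ R.Sat ((disj a l).subst γ) α β := by
  induction l generalizing a with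
  | nil =>
    rcases (h a (by simp)).subst_cases γ with ⟨w, hw⟩ | hw
    · refine .inr ⟨.actEq w, ⟨⟨.actEq w, [], by simpa using .actEq w, rfl⟩, trivial⟩, ?_⟩
      intro R α β
      rw [disj, hw]
    · refine .inl fun R α β => ?_
      rw [disj, hw]
      exact not_sat_not_zero R α β
  | cons b l ih =>
    rw [List.forall_mem_cons] at h
    have hor : ∀ (R : GroupRep.{u, v} K) α β, R.Sat ((disj a (b :: l)).subst γ) α β ↔
        R.Sat (a.subst γ) α β ∨ R.Sat ((disj b l).subst γ) α β := fun _ _ _ => Iff.rfl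
    simp only [hor]
    rcases h.1.subst_cases γ with ⟨w, hw⟩ | hw <;> rw [hw]
    · rcases ih h.2 with hf | ⟨_, ⟨⟨a', l', hl, rfl⟩, hψ⟩, hiff⟩
      · refine .inr ⟨.actEq w, ⟨⟨.actEq w, [], by simpa using .actEq w, rfl⟩, trivial⟩, ?_⟩
        intro R α β
        simp [hf]
      · refine .inr ⟨.or (.actEq w) (disj a' l'), ⟨⟨.actEq w, a' :: l', ?_, rfl⟩, trivial, hψ⟩, ?_⟩
        · rw [List.forall_mem_cons]
          exact ⟨.actEq w, hl⟩
        · intro R α β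
          exact or_congr Iff.rfl (hiff R α β)
    · simpa only [not_sat_not_zero, false_or] using ih h.2

theorem conj_subst_cases {a : Formula K} {l : List (Formula K)}
    (h : ∀ b ∈ a :: l, b.IsEquality) (γ : ℕ → FreeGroup ℕ) :
    (∀ (R : GroupRep.{u, v} K) α β, ¬ R.Sat ((conj a l).subst γ) α β) ∨
      ∃ a' l', (∀ b ∈ a' :: l', b.IsEquality ∧ b.IsActionType) ∧
        (conj a l).subst γ = conj a' l' := by
  induction l generalizing a with
  | nil =>
    rcases (h a (by simp)).subst_cases γ with ⟨w, hw⟩ | hw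
    · exact .inr ⟨.actEq w, [], by simpa using ⟨.actEq w, trivial⟩, hw⟩
    · refine .inl fun R α β => ?_
      rw [conj, hw]
      exact not_sat_not_zero R α β
  | cons b l ih =>
    rw [List.forall_mem_cons] at h
    rcases h.1.subst_cases γ with ⟨w, hw⟩ | hw
    · rcases ih h.2 with hf | ⟨a', l', hl, heq⟩
      · exact .inl fun R α β hR => hf R α β hR.2
      · refine .inr ⟨.actEq w, a' :: l', ?_, by rw [conj, subst, hw, heq]; rfl⟩
        rw [List.forall_mem_cons]
        exact ⟨⟨.actEq w, trivial⟩, hl⟩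
    · refine .inl fun R α β hR => not_sat_not_zero R α β ?_
      rw [← hw]
      exact hR.1

/-- A falsified equality is the literal `¬ (0 ≡ 0)`, and its negation is equivalent to `0 ≡ 0`, so
literals never leave their kind. -/
theorem IsLiteral.exists_subst {a : Formula K} (ha : a.IsLiteral) (γ : ℕ → FreeGroup ℕ) :
    ∃ ψ : Formula K, (ψ.IsLiteral ∧ ψ.IsActionType) ∧
      ∀ (R : GroupRep.{u, v} K) α β, R.Sat ψ α β ↔ R.Sat (a.subst γ) α β := by
  cases ha with
  | pos h =>
    rcases h.subst_cases γ with ⟨w, hw⟩ | hw <;> rw [hw]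
    · exact ⟨.actEq w, ⟨.pos (.actEq w), trivial⟩, fun _ _ _ => Iff.rfl⟩
    · exact ⟨.not (.actEq 0), ⟨.neg (.actEq 0), trivial⟩, fun _ _ _ => Iff.rfl⟩
  | neg h =>
    rw [subst]
    rcases h.subst_cases γ with ⟨w, hw⟩ | hw <;> rw [hw]
    · exact ⟨.not (.actEq w), ⟨.neg (.actEq w), trivial⟩, fun _ _ _ => Iff.rfl⟩
    · exact ⟨.actEq 0, ⟨.pos (.actEq 0), trivial⟩, fun _ _ _ => not_not.symm⟩

theorem exists_disj_subst {a : Formula K} {l : List (Formula K)}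
    (h : ∀ b ∈ a :: l, b.IsLiteral) (γ : ℕ → FreeGroup ℕ) :
    ∃ ψ : Formula K, (ψ.IsUniversal ∧ ψ.IsActionType) ∧
      ∀ (R : GroupRep.{u, v} K) α β, R.Sat ψ α β ↔ R.Sat ((disj a l).subst γ) α β := by
  induction l generalizing a with
  | nil =>
    obtain ⟨ψ, ⟨h₁, h₂⟩, h₃⟩ := (h a (by simp)).exists_subst γ
    exact ⟨ψ, ⟨⟨ψ, [], by simpa using h₁, rfl⟩, h₂⟩, h₃⟩
  | cons b l ih =>
    rw [List.forall_mem_cons] at h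
    obtain ⟨ψ, ⟨h₁, h₂⟩, h₃⟩ := h.1.exists_subst.{u, v} γ
    obtain ⟨_, ⟨⟨a', l', hl, rfl⟩, h₄⟩, h₅⟩ := ih h.2
    refine ⟨.or ψ (disj a' l'), ⟨⟨ψ, a' :: l', ?_, rfl⟩, h₂, h₄⟩,
      fun R α β => or_congr (h₃ R α β) (h₅ R α β)⟩
    rw [List.forall_mem_cons]
    exact ⟨h₁, hl⟩

end Formula

/-! ### The four kinds of classes -/

variable {X : Set (GroupRep.{u, v} K)}

theorem IsVariety.trivial_mem (hX : IsVariety X) : GroupRep.trivial K ∈ X := by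
  obtain ⟨T, hT, rfl⟩ := hX
  exact fun φ hφ α β => GroupRep.trivial_sat (hT φ hφ) α β

theorem IsPseudovariety.trivial_mem (hX : IsPseudovariety X) : GroupRep.trivial K ∈ X := by
  obtain ⟨T, hT, rfl⟩ := hX
  intro φ hφ α β
  obtain ⟨a, l, h, rfl⟩ := hT φ hφ
  exact (GroupRep.sat_disj _ a l α β).2
    ⟨a, List.mem_cons_self, GroupRep.trivial_sat (h a List.mem_cons_self) α β⟩

theorem IsQuasivariety.trivial_mem (hX : IsQuasivariety X) : GroupRep.trivial K ∈ X := by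
  obtain ⟨T, hT, rfl⟩ := hX
  intro φ hφ α β
  obtain ⟨a, l, c, -, hc, rfl⟩ := hT φ hφ
  exact .inr (GroupRep.trivial_sat hc α β)

theorem IsVariety.isActionVariety (hX : IsVariety X) (hs : IsStrictlySaturated X) :
    IsActionVariety X := by
  refine hs.axiomatizableBy hX (fun φ h => h.isQuantifierFree) fun φ γ hφ h => ?_
  rcases hφ.subst_cases γ with ⟨w, hw⟩ | hw <;> rw [hw] at h ⊢
  · exact ⟨.actEq w, ⟨.actEq w, trivial⟩, h, fun _ _ _ => id⟩
  · exact (Formula.not_sat_not_zero _ _ _ (h _ hX.trivial_mem 0 1)).elim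

theorem IsPseudovariety.isActionPseudovariety (hX : IsPseudovariety X)
    (hs : IsStrictlySaturated X) : IsActionPseudovariety X := by
  refine hs.axiomatizableBy hX ?_ ?_
  · rintro _ ⟨a, l, h, rfl⟩
    exact Formula.isQuantifierFree_disj fun b hb => (h b hb).isQuantifierFree
  · rintro _ γ ⟨a, l, hl, rfl⟩ h
    rcases Formula.disj_subst_cases.{u, v} hl γ with hf | ⟨ψ, hψ, hiff⟩
    · exact (hf _ _ _ (h _ hX.trivial_mem 0 1)).elim
    · exact ⟨ψ, hψ, fun R hR α β => (hiff R α β).2 (h R hR α β), fun R α β => (hiff R α β).1⟩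

theorem IsQuasivariety.isActionQuasivariety (hX : IsQuasivariety X)
    (hs : IsStrictlySaturated X) : IsActionQuasivariety X := by
  refine hs.axiomatizableBy hX ?_ ?_
  · rintro _ ⟨a, l, c, h, hc, rfl⟩
    exact ⟨Formula.isQuantifierFree_conj fun b hb => (h b hb).isQuantifierFree,
      hc.isQuantifierFree⟩
  · rintro _ γ ⟨a, l, c, hl, hc, rfl⟩ h
    rcases Formula.conj_subst_cases.{u, v} hl γ with hf | ⟨a', l', hl', heq⟩
    -- A false premise makes the instance vacuous, so any quasi-identity valid everywhere will do.
    · exact ⟨.imp (.conj (.actEq 0) []) (.actEq 0),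
        ⟨⟨.actEq 0, [], .actEq 0, by simpa using .actEq 0, .actEq 0, rfl⟩, trivial, trivial⟩,
        fun R _ α β => .inr (R.sat_zero α β), fun R α β _ => .inl (hf R α β)⟩
    · have hsub : (Formula.imp (.conj a l) c).subst γ =
          .imp (.conj a' l') (c.subst γ) := by rw [← heq]; rfl
      rw [hsub] at h ⊢
      rcases hc.subst_cases γ with ⟨w, hw⟩ | hw <;> rw [hw] at h ⊢
      · exact ⟨_, ⟨⟨a', l', .actEq w, fun b hb => (hl' b hb).1, .actEq w, rfl⟩,
          Formula.isActionType_conj fun b hb => (hl' b hb).2, trivial⟩, h, fun _ _ _ => id⟩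
      -- With a false conclusion, the trivial representation satisfies every premise and so refutes
      -- the instance.
      · rcases h _ hX.trivial_mem 0 1 with h | h
        · exact (h ((GroupRep.sat_conj _ _ _ _ _).2 fun b hb =>
            GroupRep.trivial_sat (hl' b hb).1 _ _)).elim
        · exact (Formula.not_sat_not_zero _ _ _ h).elim

theorem IsUniversalClass.isActionUniversalClass (hX : IsUniversalClass X)
    (hs : IsStrictlySaturated X) : IsActionUniversalClass X := by
  refine hs.axiomatizableBy hX ?_ ?_
  · rintro _ ⟨a, l, h, rfl⟩
    exact Formula.isQuantifierFree_disj fun b hb => (h b hb).isQuantifierFree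
  · rintro _ γ ⟨a, l, hl, rfl⟩ h
    obtain ⟨ψ, hψ, hiff⟩ := Formula.exists_disj_subst.{u, v} hl γ
    exact ⟨ψ, hψ, fun R hR α β => (hiff R α β).2 (h R hR α β), fun R α β => (hiff R α β).1⟩

theorem AxiomatizableBy.isActionAxiomatizable {P : Formula K → Prop}
    (hX : AxiomatizableBy (fun φ => P φ ∧ φ.IsActionType) X) : IsActionAxiomatizable X := by
  obtain ⟨T, hT, h⟩ := hX
  exact ⟨T, fun φ hφ => (hT φ hφ).2, h⟩

theorem isStrictlySaturated_iff {P : Formula K → Prop}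
    (h : IsStrictlySaturated X → AxiomatizableBy (fun φ => P φ ∧ φ.IsActionType) X) :
    (AxiomatizableBy (fun φ => P φ ∧ φ.IsActionType) X ↔ IsStrictlySaturated X) ∧
      (IsActionAxiomatizable X ↔ IsStrictlySaturated X) :=
  ⟨⟨fun hX => hX.isActionAxiomatizable.isStrictlySaturated, h⟩,
    ⟨fun hX => hX.isStrictlySaturated, fun hs => (h hs).isActionAxiomatizable⟩⟩

end Semantics

end ActionLogic

theorem theorem2p2 (K : Type u) [CommRing K] (X : Set (GroupRep.{u, v} K)) :
    (IsVariety X →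
      (IsActionVariety X ↔ IsStrictlySaturated X) ∧
      (IsActionAxiomatizable X ↔ IsStrictlySaturated X)) ∧
    (IsPseudovariety X →
      (IsActionPseudovariety X ↔ IsStrictlySaturated X) ∧
      (IsActionAxiomatizable X ↔ IsStrictlySaturated X)) ∧
    (IsQuasivariety X →
      (IsActionQuasivariety X ↔ IsStrictlySaturated X) ∧
      (IsActionAxiomatizable X ↔ IsStrictlySaturated X)) ∧
    (IsUniversalClass X →
      (IsActionUniversalClass X ↔ IsStrictlySaturated X) ∧
      (IsActionAxiomatizable X ↔ IsStrictlySaturated X)) := by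
  exact ⟨fun hX => isStrictlySaturated_iff hX.isActionVariety,
    fun hX => isStrictlySaturated_iff hX.isActionPseudovariety,
    fun hX => isStrictlySaturated_iff hX.isActionQuasivariety,
    fun hX => isStrictlySaturated_iff hX.isActionUniversalClass⟩
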